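/- Let $G$ be a finitely generated group. Write $x^g=g^{-1}xg$ and $[x,y]=x^{-1}y^{-1}xy$. The $n$-fold non-abelian tensor powers $G^{\otimes n}$ $(n\ge 1)$ are defined inductively, together with a right action of $G$ on $G^{\otimes n}$ by automorphisms and a $G$-equivariant homomorphism $\lambda_n\colon G^{\otimes n}\to G$ (with $G$ acting on itself by conjugation), as follows. For $n=1$, $G^{\otimes 1}=G$ with the conjugation action and $\lambda_1=\mathrm{id}$. Given $T=G^{\otimes n}$, let $T$ act on $G$ by $g^{t}=g^{\lambda_n(t)}$; then $G^{\otimes (n+1)}=T\otimes G$ is the group generated by the symbols $t\otimes g$ $(t\in T,\ g\in G)$ subject to the relations $$tt_1\otimes g=(t^{t_1}\otimes g^{t_1})(t_1\otimes g),\qquad t\otimes gg_1=(t\otimes g_1)(t^{g_1}\otimes g^{g_1})$$ for all $t,t_1\in T$ and $g,g_1\in G$ (where $t^{t_1}=t_1^{-1}tt_1$), with the action $(t\otimes x)^g=t^g\otimes x^g$ and the homomorphism $\lambda_{n+1}(t\otimes x)=[\lambda_n(t),x]$. (In particular $G^{\otimes 2}=G\otimes G$ is the non-abelian tensor square.) Then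 for every $n\ge 1$: 1. $G^{\otimes n}$ is finite if and only if $G$ is finite. 2. $G^{\otimes n}$ is polycyclic if and only if $G$ is polycyclic. Here a group is polycyclic if it has a finite series $1=H_0\trianglelefteq H_1\trianglelefteq\cdots\trianglelefteq H_k=G$ with cyclic factors $H_{i+1}/H_i$. -/

import Mathlib

universe u v

open MulOpposite

/-- The right action of a group on itself by conjugation, `g ^ x = x⁻¹ * g * x`.
A right action of `H` on a group `G` by automorphisms is given as a homomorphism
`Hᵐᵒᵖ →* MulAut G`. -/
def rightConj (G : Type u) [Group G] : Gᵐᵒᵖ →* MulAut G where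
  toFun x := MulAut.conj (unop x)⁻¹
  map_one' := by simp
  map_mul' x y := by simp

theorem rightConj_apply {G : Type u} [Group G] (x g : G) :
    rightConj G (op x) g = x⁻¹ * g * x := by
  simp [rightConj]

/-- The defining relators of the non-abelian tensor product of `G` and `H`, with `H` acting on `G`
through `α` and `G` acting on `H` through `β` (both on the right), and each acting on itself by
conjugation:
`g g₁ ⊗ h = (g ^ g₁ ⊗ h ^ g₁) (g₁ ⊗ h)` and `g ⊗ h h₁ = (g ⊗ h₁) (g ^ h₁ ⊗ h ^ h₁)`. -/
inductive NonabTensorRel {G : Type u} {H : Type v} [Group G] [Group H]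
    (α : Hᵐᵒᵖ →* MulAut G) (β : Gᵐᵒᵖ →* MulAut H) : FreeGroup (G × H) → Prop
  | left (g g₁ : G) (h : H) : NonabTensorRel α β
      (FreeGroup.of (g * g₁, h) *
        (FreeGroup.of (g₁⁻¹ * g * g₁, β (op g₁) h) * FreeGroup.of (g₁, h))⁻¹)
  | right (g : G) (h h₁ : H) : NonabTensorRel α β
      (FreeGroup.of (g, h * h₁) *
        (FreeGroup.of (g, h₁) * FreeGroup.of (α (op h₁) g, h₁⁻¹ * h * h₁))⁻¹)

/-- The non-abelian tensor product `G ⊗ H` of two groups acting on each other on the right: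
the group generated by the symbols `g ⊗ h` subject to the relations above. -/
def NonabTensor {G : Type u} {H : Type v} [Group G] [Group H]
    (α : Hᵐᵒᵖ →* MulAut G) (β : Gᵐᵒᵖ →* MulAut H) : Type (max u v) :=
  PresentedGroup {r | NonabTensorRel α β r}

namespace NonabTensor

section

variable {G : Type u} {H : Type v} [Group G] [Group H]

instance instGroup (α : Hᵐᵒᵖ →* MulAut G) (β : Gᵐᵒᵖ →* MulAut H) : Group (NonabTensor α β) :=
  inferInstanceAs (Group (PresentedGroup {r | NonabTensorRel α β r}))

variable {α : Hᵐᵒᵖ →* MulAut G} {β : Gᵐᵒᵖ →* MulAut H}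

/-- The generator `g ⊗ h`. -/
def tmul (α : Hᵐᵒᵖ →* MulAut G) (β : Gᵐᵒᵖ →* MulAut H) (g : G) (h : H) : NonabTensor α β :=
  PresentedGroup.of (rels := {r | NonabTensorRel α β r}) (g, h)

theorem mul_tmul (g g₁ : G) (h : H) :
    tmul α β (g * g₁) h = tmul α β (g₁⁻¹ * g * g₁) (β (op g₁) h) * tmul α β g₁ h :=
  mul_inv_eq_one.mp (PresentedGroup.one_of_mem (rels := {r | NonabTensorRel α β r})
    (NonabTensorRel.left g g₁ h))

theorem tmul_mul (g : G) (h h₁ : H) :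
    tmul α β g (h * h₁) = tmul α β g h₁ * tmul α β (α (op h₁) g) (h₁⁻¹ * h * h₁) :=
  mul_inv_eq_one.mp (PresentedGroup.one_of_mem (rels := {r | NonabTensorRel α β r})
    (NonabTensorRel.right g h h₁))

/-- The homomorphism `G ⊗ H →* K` determined by a map on generators that respects the relations. -/
def lift {K : Type*} [Group K] (f : G → H → K)
    (hl : ∀ g g₁ h, f (g * g₁) h = f (g₁⁻¹ * g * g₁) (β (op g₁) h) * f g₁ h)
    (hr : ∀ g h h₁, f g (h * h₁) = f g h₁ * f (α (op h₁) g) (h₁⁻¹ * h * h₁)) :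
    NonabTensor α β →* K :=
  PresentedGroup.toGroup (rels := {r | NonabTensorRel α β r}) (f := fun p : G × H => f p.1 p.2) (by
    rintro r (⟨g, g₁, h⟩ | ⟨g, h, h₁⟩)
    · simpa [mul_inv_eq_one] using (mul_inv_eq_one.mpr (hl g g₁ h))
    · simpa [mul_inv_eq_one] using (mul_inv_eq_one.mpr (hr g h h₁)))

@[simp] theorem lift_tmul {K : Type*} [Group K] (f : G → H → K)
    (hl : ∀ g g₁ h, f (g * g₁) h = f (g₁⁻¹ * g * g₁) (β (op g₁) h) * f g₁ h)
    (hr : ∀ g h h₁, f g (h * h₁) = f g h₁ * f (α (op h₁) g) (h₁⁻¹ * h * h₁)) (g : G) (h : H) :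
    lift f hl hr (tmul α β g h) = f g h :=
  PresentedGroup.toGroup.of _

theorem hom_ext {K : Type*} [Group K] {φ ψ : NonabTensor α β →* K}
    (h : ∀ g k, φ (tmul α β g k) = ψ (tmul α β g k)) : φ = ψ :=
  PresentedGroup.ext (rels := {r | NonabTensorRel α β r}) fun p => h p.1 p.2

end

end NonabTensor

/-- A group `carrier` on which `G` acts on the right by automorphisms, with a `G`-equivariant
homomorphism to `G` (where `G` acts on itself by conjugation). -/
structure GroupOver (G : Type u) [Group G] where
  carrier : Type u
  [group : Group carrier]
  act : Gᵐᵒᵖ →* MulAut carrier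
  toBase : carrier →* G
  equivariant : ∀ (g : G) (t : carrier), toBase (act (op g) t) = g⁻¹ * toBase t * g

namespace GroupOver

attribute [instance] GroupOver.group

variable {G : Type u} [Group G]

/-- `G` itself, with the conjugation action and the identity. -/
def self (G : Type u) [Group G] : GroupOver G where
  carrier := G
  act := rightConj G
  toBase := MonoidHom.id G
  equivariant g t := by simp [rightConj_apply]

/-- The right action of `carrier` on `G`: `g ^ t` is the conjugate of `g` by the image of `t`. -/
def actOnBase (T : GroupOver G) : T.carrierᵐᵒᵖ →* MulAut G :=
  (rightConj G).comp T.toBase.op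

theorem actOnBase_apply (T : GroupOver G) (t : T.carrier) (g : G) :
    T.actOnBase (op t) g = (T.toBase t)⁻¹ * g * T.toBase t :=
  rightConj_apply _ _

/-- The group `T ⊗ G`. -/
abbrev Tensor (T : GroupOver G) : Type u := NonabTensor T.act T.actOnBase

/-- The endomorphism `t ⊗ x ↦ t ^ g ⊗ x ^ g` of `T ⊗ G`. -/
def diagHom (T : GroupOver G) (g : G) : T.Tensor →* T.Tensor :=
  NonabTensor.lift
    (fun t x => NonabTensor.tmul T.act T.actOnBase (T.act (op g) t) (g⁻¹ * x * g))
    (by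
      intro t t₁ x
      rw [map_mul, NonabTensor.mul_tmul]
      simp only [map_mul, map_inv, actOnBase_apply, T.equivariant]
      congr 2
      group)
    (by
      intro t x x₁
      have e : g⁻¹ * (x * x₁) * g = (g⁻¹ * x * g) * (g⁻¹ * x₁ * g) := by group
      rw [e, NonabTensor.tmul_mul]
      simp only [← MulAut.mul_apply, ← map_mul, ← op_mul]
      congr 2
      · congr 3
        group
      · group)

theorem diagHom_tmul (T : GroupOver G) (g : G) (t : T.carrier) (x : G) :
    T.diagHom g (NonabTensor.tmul T.act T.actOnBase t x) =
      NonabTensor.tmul T.act T.actOnBase (T.act (op g) t) (g⁻¹ * x * g) :=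
  NonabTensor.lift_tmul _ _ _ _ _

theorem diagHom_one (T : GroupOver G) : T.diagHom 1 = MonoidHom.id _ :=
  NonabTensor.hom_ext fun t x => by simp [diagHom_tmul]

theorem diagHom_comp (T : GroupOver G) (g h : G) :
    (T.diagHom g).comp (T.diagHom h) = T.diagHom (h * g) :=
  NonabTensor.hom_ext fun t x => by
    simp only [MonoidHom.comp_apply, diagHom_tmul, ← MulAut.mul_apply, ← map_mul, ← op_mul]
    congr 1
    group

/-- The diagonal right action of `G` on `T ⊗ G`: `(t ⊗ x) ^ g = t ^ g ⊗ x ^ g`. -/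
def diagAct (T : GroupOver G) : Gᵐᵒᵖ →* MulAut T.Tensor where
  toFun g := MonoidHom.toMulEquiv (T.diagHom (unop g)) (T.diagHom (unop g)⁻¹)
    (by rw [diagHom_comp, mul_inv_cancel, diagHom_one])
    (by rw [diagHom_comp, inv_mul_cancel, diagHom_one])
  map_one' := by
    ext t
    exact DFunLike.congr_fun T.diagHom_one t
  map_mul' g h := by
    ext t
    exact (DFunLike.congr_fun (T.diagHom_comp (unop g) (unop h)) t).symm

theorem diagAct_tmul (T : GroupOver G) (g : G) (t : T.carrier) (x : G) :
    T.diagAct (op g) (NonabTensor.tmul T.act T.actOnBase t x) =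
      NonabTensor.tmul T.act T.actOnBase (T.act (op g) t) (g⁻¹ * x * g) :=
  T.diagHom_tmul g t x

/-- The commutator homomorphism `T ⊗ G →* G`, `t ⊗ x ↦ [s, x] = s⁻¹ x⁻¹ s x`, where `s` is the
image of `t` in `G`. -/
def commHom (T : GroupOver G) : T.Tensor →* G :=
  NonabTensor.lift (fun t x => (T.toBase t)⁻¹ * x⁻¹ * T.toBase t * x)
    (by
      intro t t₁ x
      simp only [map_mul, map_inv, actOnBase_apply]
      group)
    (by
      intro t x x₁
      simp only [T.equivariant]
      group)

theorem commHom_tmul (T : GroupOver G) (t : T.carrier) (x : G) :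
    T.commHom (NonabTensor.tmul T.act T.actOnBase t x) =
      (T.toBase t)⁻¹ * x⁻¹ * T.toBase t * x :=
  NonabTensor.lift_tmul _ _ _ _ _

theorem commHom_diagAct (T : GroupOver G) (g : G) (y : T.Tensor) :
    T.commHom (T.diagAct (op g) y) = g⁻¹ * T.commHom y * g := by
  have h : T.commHom.comp (T.diagHom g) = (rightConj G (op g)).toMonoidHom.comp T.commHom :=
    NonabTensor.hom_ext fun t x => by
      simp only [MonoidHom.comp_apply, diagHom_tmul, commHom_tmul, T.equivariant,
        MulEquiv.coe_toMonoidHom, rightConj_apply]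
      group
  exact (DFunLike.congr_fun h y).trans (rightConj_apply _ _)

/-- `T ⊗ G` with the diagonal action of `G` and the commutator homomorphism to `G`. -/
def tensor (T : GroupOver G) : GroupOver G where
  carrier := T.Tensor
  act := T.diagAct
  toBase := T.commHom
  equivariant := T.commHom_diagAct

/-- The `n`-fold tensor product with its `G`-action and the homomorphism
`((g₁ ⊗ g₂) ⊗ ⋯) ⊗ gₙ ↦ [g₁, g₂, …, gₙ]`: `G^{⊗1} = G` and `G^{⊗(n+1)} = G^{⊗n} ⊗ G`.
The value at `n = 0` is a placeholder. -/
def tensorPow (G : Type u) [Group G] : ℕ → GroupOver G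
  | 0 => self G
  | 1 => self G
  | n + 2 => (tensorPow G (n + 1)).tensor

end GroupOver

/-- The `n`-fold non-abelian tensor product `G^{⊗n}`, for `n ≥ 1`. -/
abbrev NFoldTensor (G : Type u) [Group G] (n : ℕ) : Type u :=
  (GroupOver.tensorPow G n).carrier

/-- A group is polycyclic if it has a finite series `1 = H₀ ⊴ H₁ ⊴ ⋯ ⊴ Hₖ = G`, each term normal
in the next, with cyclic factors. -/
def IsPolycyclic (G : Type u) [Group G] : Prop :=
  ∃ (k : ℕ) (H : ℕ → Subgroup G), H 0 = ⊥ ∧ H k = ⊤ ∧ ∀ i < k, H i ≤ H (i + 1) ∧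
    ∃ _ : ((H i).subgroupOf (H (i + 1))).Normal,
      IsCyclic (H (i + 1) ⧸ (H i).subgroupOf (H (i + 1)))

/-!
The homomorphism `λₙ : G^{⊗n} → G` satisfies the Peiffer identity `t ^ λₙ(s) = s⁻¹ t s`, so its
kernel is central, and its image contains the `n`-th term of the lower central series of `G`.

From `G^{⊗n}` to `G`: the quotient of `G` by that term is nilpotent and finitely generated, hence
polycyclic, and it is finite once the abelianization of `G` is. A homomorphism `φ : G → ℤ` induces
`g₁ ⊗ ⋯ ⊗ gₙ ↦ φ(g₁) ⋯ φ(gₙ)`, which is nonzero if `φ` is; so if `G^{⊗n}` is finite, every such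
`φ` vanishes and the abelianization is finite.

From `G` to `G^{⊗n}`, inductively for a Peiffer `T` over `G`: `T ⊗ G` is a central extension of a
subgroup of `G`. If `T` and `G` are finite, averaging the cocycles `g ↦ t ⊗ g` and then
`t ↦ ∏ t ⊗ g` shows that the abelianization of `T ⊗ G` is torsion, so finite, and the commutator
subgroup is finite by Schur's theorem. If `T` and `G` are polycyclic, a central extension of a
polycyclic group is polycyclic as soon as it is finitely generated, and finite generation of
`T ⊗ G` follows by climbing the derived series of `T` with the identity
`t t₁ ⊗ g = (t ⊗ g) ([t, g] ⊗ λ(t₁)) (t₁ ⊗ g)`.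
-/

open Subgroup Relation
open scoped commutatorElement

section Polycyclic

variable {E : Type*} [Group E]

/-- One step of a polycyclic series: `A ⊴ B` with `B / A` cyclic. -/
def CyclicStep (A B : Subgroup E) : Prop :=
  A ≤ B ∧ ∃ _ : (A.subgroupOf B).Normal, IsCyclic (B ⧸ A.subgroupOf B)

/-- There is a polycyclic series from the subgroup `A` up to the subgroup `B`. -/
abbrev HasPolycyclicSeries (A B : Subgroup E) : Prop :=
  ReflTransGen CyclicStep A B

theorem isPolycyclic_iff_hasPolycyclicSeries :
    IsPolycyclic E ↔ HasPolycyclicSeries (⊥ : Subgroup E) ⊤ := by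
  have exists_series_iff (B : Subgroup E) :
      (∃ (k : ℕ) (H : ℕ → Subgroup E), H 0 = ⊥ ∧ H k = B ∧ ∀ i < k, CyclicStep (H i) (H (i + 1)))
        ↔ HasPolycyclicSeries ⊥ B := by
    constructor
    · rintro ⟨k, H, h0, rfl, hH⟩
      rw [← h0]
      have h_le : ∀ i ≤ k, HasPolycyclicSeries (H 0) (H i) := fun i => by
        induction i with
        | zero => exact fun _ => .refl
        | succ i ih => exact fun hi => (ih (Nat.le_of_succ_le hi)).tail (hH i hi)
      exact h_le k le_rfl
    · intro h
      induction h with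
      | refl => exact ⟨0, fun _ => ⊥, rfl, rfl, fun _ h => absurd h (Nat.not_lt_zero _)⟩
      | @tail B C _ hBC ih =>
        obtain ⟨k, H, h0, rfl, hH⟩ := ih
        refine ⟨k + 1, fun i => if i ≤ k then H i else C, by simpa using h0, by simp,
          fun i hi => ?_⟩
        rcases (Nat.lt_succ_iff.mp hi).lt_or_eq with hik | rfl
        · simpa [hik.le, Nat.succ_le_of_lt hik] using hH i hik
        · simpa using hBC
  exact exists_series_iff ⊤

theorem CyclicStep.exists_eq_sup_zpowers {A B : Subgroup E} (h : CyclicStep A B) :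
    ∃ x ∈ normalizer (A : Set E), B = A ⊔ zpowers x := by
  obtain ⟨hAB, _, hcyc⟩ := h
  obtain ⟨q, hq⟩ := hcyc.exists_generator
  obtain ⟨x, rfl⟩ := QuotientGroup.mk_surjective q
  refine ⟨x, (normal_subgroupOf_iff_le_normalizer hAB).mp ‹_› x.2, le_antisymm (fun b hb => ?_)
    (sup_le hAB ((zpowers_le).mpr x.2))⟩
  obtain ⟨n, hn⟩ := mem_zpowers_iff.mp (hq (QuotientGroup.mk (⟨b, hb⟩ : B)))
  rw [← QuotientGroup.mk_zpow, QuotientGroup.eq, mem_subgroupOf] at hn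
  have hb : b = (x : E) ^ n * (((x : E) ^ n)⁻¹ * b) := by group
  rw [hb]
  exact mul_mem (mem_sup_right (zpow_mem (mem_zpowers _) _)) (mem_sup_left (by simpa using hn))

theorem cyclicStep_sup_zpowers {A : Subgroup E} {x : E} (hx : x ∈ normalizer (A : Set E)) :
    CyclicStep A (A ⊔ zpowers x) := by
  have hle : A ⊔ zpowers x ≤ normalizer (A : Set E) := sup_le le_normalizer (zpowers_le.mpr hx)
  have hnormal := (normal_subgroupOf_iff_le_normalizer le_sup_left).mpr hle
  refine ⟨le_sup_left, hnormal, isCyclic_of_surjective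
    ((QuotientGroup.mk' (A.subgroupOf (A ⊔ zpowers x))).comp
      (inclusion (le_sup_right : zpowers x ≤ A ⊔ zpowers x))) fun q => ?_⟩
  obtain ⟨⟨b, hb⟩, rfl⟩ := QuotientGroup.mk_surjective q
  have hb' : b ∈ ((zpowers x ⊔ A : Subgroup E) : Set E) := by rwa [sup_comm]
  rw [coe_mul_of_left_le_normalizer_right _ _ (zpowers_le.mpr hx)] at hb'
  obtain ⟨y, hy, a, ha, rfl⟩ := hb'
  refine ⟨⟨y, hy⟩, (QuotientGroup.eq).mpr ?_⟩
  rw [mem_subgroupOf]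
  simpa using ha

namespace CyclicStep

theorem map {F : Type*} [Group F] (f : E →* F) {A B : Subgroup E} (h : CyclicStep A B) :
    CyclicStep (A.map f) (B.map f) := by
  obtain ⟨x, hx, rfl⟩ := h.exists_eq_sup_zpowers
  rw [Subgroup.map_sup, MonoidHom.map_zpowers]
  exact cyclicStep_sup_zpowers (le_normalizer_map f (mem_map_of_mem f hx))

theorem comap {F : Type*} [Group F] (f : F →* E) {A B : Subgroup E} (h : CyclicStep A B) :
    CyclicStep (A.comap f) (B.comap f) := by
  obtain ⟨hAB, hnormal, hcyc⟩ := h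
  have hker : (A.comap f).subgroupOf (B.comap f) = (A.subgroupOf B).comap (f.subgroupComap B) := rfl
  have hnormal' : ((A.comap f).subgroupOf (B.comap f)).Normal := by
    rw [hker]
    infer_instance
  refine ⟨comap_mono hAB, hnormal', isCyclic_of_injective
    (QuotientGroup.map _ (A.subgroupOf B) (f.subgroupComap B) hker.le) ?_⟩
  rw [← MonoidHom.ker_eq_bot_iff, QuotientGroup.ker_map, ← hker, QuotientGroup.map_mk'_self]

end CyclicStep

namespace HasPolycyclicSeries

theorem map {F : Type*} [Group F] (f : E →* F) {A B : Subgroup E} (h : HasPolycyclicSeries A B) :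
    HasPolycyclicSeries (A.map f) (B.map f) :=
  ReflTransGen.lift (Subgroup.map f) (fun _ _ => CyclicStep.map f) _ _ h

theorem comap {F : Type*} [Group F] (f : F →* E) {A B : Subgroup E} (h : HasPolycyclicSeries A B) :
    HasPolycyclicSeries (A.comap f) (B.comap f) :=
  ReflTransGen.lift (Subgroup.comap f) (fun _ _ => CyclicStep.comap f) _ _ h

theorem fg {A : Subgroup E} (h : HasPolycyclicSeries ⊥ A) : A.FG := by
  induction h with
  | refl => exact FG.bot
  | tail _ hAB ih =>
    obtain ⟨x, _, rfl⟩ := hAB.exists_eq_sup_zpowers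
    exact ih.sup ((fg_iff _).mpr ⟨{x}, (zpowers_eq_closure x).symm, Set.finite_singleton x⟩)

theorem isSolvable {A : Subgroup E} (h : HasPolycyclicSeries ⊥ A) : Group.IsSolvable A := by
  induction h with
  | refl => infer_instance
  | @tail A B _ hAB ih =>
    obtain ⟨hle, _, _⟩ := hAB
    have := Group.isSolvable_of_comm (IsCyclic.commGroup (α := B ⧸ A.subgroupOf B)).mul_comm
    exact Group.isSolvable_of_ker_le_range (inclusion hle) (QuotientGroup.mk' (A.subgroupOf B))
      (by rw [QuotientGroup.ker_mk', inclusion_range])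

theorem sup_closure {A : Subgroup E} {F : Set E} (hF : F.Finite)
    (h : ∀ x ∈ F, ∀ B, A ≤ B → x ∈ normalizer (B : Set E)) :
    HasPolycyclicSeries A (A ⊔ closure F) := by
  induction F, hF using Set.Finite.induction_on with
  | empty => rw [Subgroup.closure_empty, sup_bot_eq]
  | @insert x F _ _ ih =>
    have hx := h x (Set.mem_insert _ _) (A ⊔ closure F) le_sup_left
    have hsup : A ⊔ closure (insert x F) = A ⊔ closure F ⊔ zpowers x := by
      rw [Set.insert_eq, Set.union_comm, Subgroup.closure_union, ← zpowers_eq_closure, sup_assoc]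
    rw [hsup]
    exact (ih fun y hy => h y (Set.mem_insert_of_mem _ hy)).tail (cyclicStep_sup_zpowers hx)

theorem sup_closure_of_subset_center {A : Subgroup E} {F : Set E} (hF : F.Finite)
    (hFc : F ⊆ center E) : HasPolycyclicSeries A (A ⊔ closure F) :=
  sup_closure hF fun _ hx _ _ => center_le_normalizer _ (hFc hx)

theorem sup_closure_of_commutator_le {A : Subgroup E} {F : Set E} (hF : F.Finite)
    (hA : _root_.commutator E ≤ A) : HasPolycyclicSeries A (A ⊔ closure F) :=
  sup_closure hF fun _ _ B hAB => by
    have hB : B.Normal := Normal.of_commutator_le _ (hA.trans hAB)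
    rw [normalizer_eq_top]
    trivial

end HasPolycyclicSeries

namespace IsPolycyclic

theorem of_injective {F : Type*} [Group F] (hE : IsPolycyclic E) {f : F →* E}
    (hf : Function.Injective f) : IsPolycyclic F := by
  rw [isPolycyclic_iff_hasPolycyclicSeries] at hE ⊢
  simpa only [MonoidHom.comap_bot, (MonoidHom.ker_eq_bot_iff f).mpr hf, comap_top] using hE.comap f

theorem of_surjective {F : Type*} [Group F] (hE : IsPolycyclic E) {f : E →* F}
    (hf : Function.Surjective f) : IsPolycyclic F := by
  rw [isPolycyclic_iff_hasPolycyclicSeries] at hE ⊢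
  simpa only [Subgroup.map_bot, map_top_of_surjective f hf] using hE.map f

theorem of_ker {F : Type*} [Group F] {f : E →* F} (hker : IsPolycyclic f.ker)
    (hF : IsPolycyclic F) : IsPolycyclic E := by
  rw [isPolycyclic_iff_hasPolycyclicSeries] at hker hF ⊢
  have hbot : HasPolycyclicSeries (⊥ : Subgroup E) f.ker := by
    simpa only [Subgroup.map_bot, ← MonoidHom.range_eq_map, range_subtype] using
      hker.map f.ker.subtype
  have htop : HasPolycyclicSeries f.ker ⊤ := by
    simpa only [MonoidHom.comap_bot, comap_top] using hF.comap f
  exact hbot.trans htop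

theorem of_subsingleton [Subsingleton E] : IsPolycyclic E := by
  rw [isPolycyclic_iff_hasPolycyclicSeries, Subsingleton.elim (⊥ : Subgroup E) ⊤]

theorem fg (hE : IsPolycyclic E) : Group.FG E :=
  Group.fg_def.mpr (isPolycyclic_iff_hasPolycyclicSeries.mp hE).fg

theorem fg_subgroup (hE : IsPolycyclic E) (A : Subgroup E) : A.FG :=
  (Group.fg_iff_subgroup_fg A).mp (hE.of_injective A.subtype_injective).fg

theorem isSolvable (hE : IsPolycyclic E) : Group.IsSolvable E :=
  have := (isPolycyclic_iff_hasPolycyclicSeries.mp hE).isSolvable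
  Group.isSolvable_of_surjective (f := (⊤ : Subgroup E).subtype) fun x => ⟨⟨x, trivial⟩, rfl⟩

end IsPolycyclic

section CentralExtension

variable {P : Type*} [Group P] {f : E →* P}

theorem subgroup_fg_map {D : Subgroup E} (hD : D.FG) (f : E →* P) : (D.map f).FG := by
  obtain ⟨A, rfl, hA⟩ := (fg_iff _).mp hD
  exact (fg_iff _).mpr ⟨f '' A, (f.map_closure A).symm, hA.image f⟩

theorem exists_finite_subset_ker_le_sup_closure {D D₁ : Subgroup E} (hD₁ : D₁.FG)
    (hle : D₁.map f ≤ D.map f) :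
    ∃ F ⊆ (f.ker : Set E), F.Finite ∧ D₁ ≤ D ⊔ closure F := by
  obtain ⟨A, rfl, hA⟩ := (fg_iff _).mp hD₁
  have h_decomp (a : E) (ha : a ∈ A) : ∃ z ∈ f.ker, a * z⁻¹ ∈ D := by
    obtain ⟨d, hd, z, hz, rfl⟩ :=
      mem_sup_of_normal_right.mp (map_le_map_iff.mp hle (mem_closure_of_mem ha))
    exact ⟨z, hz, by simpa using hd⟩
  choose! z hz hzD using h_decomp
  refine ⟨z '' A, Set.image_subset_iff.mpr hz, hA.image z, (closure_le _).mpr fun a ha => ?_⟩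
  rw [← inv_mul_cancel_right a (z a)]
  exact mul_mem (mem_sup_left (hzD a ha))
    (mem_sup_right (mem_closure_of_mem (Set.mem_image_of_mem z ha)))

theorem mem_normalizer_sup_of_map_conj_le {D Z : Subgroup E} (hZ : Z ≤ center E) {y : E}
    (hy : D.map (MulAut.conj y : E →* E) ≤ D ⊔ Z)
    (hy_inv : D.map (MulAut.conj y⁻¹ : E →* E) ≤ D ⊔ Z) :
    y ∈ normalizer ((D ⊔ Z : Subgroup E) : Set E) := by
  have conj_mem (u : E) (hu : D.map (MulAut.conj u : E →* E) ≤ D ⊔ Z) (b : E) (hb : b ∈ D ⊔ Z) :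
      u * b * u⁻¹ ∈ D ⊔ Z := by
    have hZu : Z.map (MulAut.conj u : E →* E) ≤ D ⊔ Z := by
      rintro _ ⟨z, hz, rfl⟩
      have huz : MulAut.conj u z = z := by
        rw [MulAut.conj_apply, mem_center_iff.mp (hZ hz) u, mul_inv_cancel_right]
      exact mem_sup_right (huz.symm ▸ hz)
    have hmap : (D ⊔ Z).map (MulAut.conj u : E →* E) ≤ D ⊔ Z :=
      (Subgroup.map_sup _ _ _).trans_le (sup_le hu hZu)
    exact hmap (mem_map_of_mem _ hb)
  refine mem_normalizer_iff.mpr fun b => ⟨conj_mem y hy b, fun hb => ?_⟩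
  have := conj_mem y⁻¹ hy_inv _ hb
  simpa only [inv_inv, mul_assoc, inv_mul_cancel_left, inv_mul_cancel, mul_one] using this

theorem exists_finite_subset_ker_mem_normalizer (hker : f.ker ≤ center E) {D : Subgroup E}
    (hD : D.FG) {y : E} (hy : f y ∈ normalizer (D.map f : Set P)) :
    ∃ F ⊆ (f.ker : Set E), F.Finite ∧ y ∈ normalizer ((D ⊔ closure F : Subgroup E) : Set E) := by
  have map_conj_le (u : E) (hu : f u ∈ normalizer (D.map f : Set P)) :
      (D.map (MulAut.conj u : E →* E)).map f ≤ D.map f := by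
    rintro _ ⟨_, ⟨d, hd, rfl⟩, rfl⟩
    simpa using (mem_normalizer_iff.mp hu (f d)).mp (mem_map_of_mem f hd)
  obtain ⟨F, hF, hfin, hle⟩ := exists_finite_subset_ker_le_sup_closure
    ((subgroup_fg_map hD (MulAut.conj y : E →* E)).sup
      (subgroup_fg_map hD (MulAut.conj y⁻¹ : E →* E)))
    ((Subgroup.map_sup _ _ f).trans_le
      (sup_le (map_conj_le y hy) (map_conj_le y⁻¹ (by simpa using hy))))
  exact ⟨F, hF, hfin, mem_normalizer_sup_of_map_conj_le ((closure_le _).mpr (hF.trans hker))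
    (le_sup_left.trans hle) (le_sup_right.trans hle)⟩

theorem exists_hasPolycyclicSeries_map_eq (hf : Function.Surjective f) (hker : f.ker ≤ center E)
    {H : Subgroup P} (hH : HasPolycyclicSeries ⊥ H) :
    ∃ D : Subgroup E, HasPolycyclicSeries ⊥ D ∧ D.map f = H := by
  induction hH with
  | refl => exact ⟨⊥, .refl, Subgroup.map_bot f⟩
  | @tail A B _ hAB ih =>
    obtain ⟨D, hD, rfl⟩ := ih
    obtain ⟨x, hx, rfl⟩ := hAB.exists_eq_sup_zpowers
    obtain ⟨y, rfl⟩ := hf x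
    obtain ⟨F, hF, hfin, hy⟩ := exists_finite_subset_ker_mem_normalizer hker hD.fg hx
    have hF_map : (closure F).map f = ⊥ := (Subgroup.map_eq_bot_iff _).mpr ((closure_le _).mpr hF)
    refine ⟨D ⊔ closure F ⊔ zpowers y, .tail ?_ (cyclicStep_sup_zpowers hy), ?_⟩
    · exact hD.trans (HasPolycyclicSeries.sup_closure_of_subset_center hfin (hF.trans hker))
    · rw [Subgroup.map_sup, Subgroup.map_sup, hF_map, sup_bot_eq, MonoidHom.map_zpowers]

/-- Central extensions of polycyclic groups need not be polycyclic, since the center may be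
infinitely generated; here a polycyclic `D` with `E = D Z(E)` contains the commutator subgroup of
`E`, so finitely many generators of `E` complete `D` to a polycyclic series. -/
theorem IsPolycyclic.of_surjective_of_ker_le_center [Group.FG E] (hP : IsPolycyclic P)
    (hf : Function.Surjective f) (hker : f.ker ≤ center E) : IsPolycyclic E := by
  rw [isPolycyclic_iff_hasPolycyclicSeries] at hP ⊢
  obtain ⟨D, hD, hmap⟩ := exists_hasPolycyclicSeries_map_eq hf hker hP
  have hsup : D ⊔ center E = ⊤ := by
    refine eq_top_iff.mpr (le_trans ?_ (sup_le_sup_left hker D))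
    rw [← comap_map_eq, hmap, comap_top]
  have hnormal : D.Normal := normalizer_eq_top_iff.mp <| eq_top_iff.mpr <|
    hsup.symm.le.trans (sup_le le_normalizer (center_le_normalizer _))
  have hcomm : _root_.commutator E ≤ D :=
    Normal.commutator_le_of_self_sup_commutative_eq_top hsup inferInstance
  obtain ⟨S, hS, hfin⟩ := Group.fg_iff.mp ‹Group.FG E›
  simpa [hS] using hD.trans (HasPolycyclicSeries.sup_closure_of_commutator_le hfin hcomm)

theorem IsPolycyclic.of_isNilpotent [Group.IsNilpotent E] [Group.FG E] : IsPolycyclic E := by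
  refine Group.nilpotent_center_quotient_ind (P := fun N _ _ => Group.FG N → IsPolycyclic N) E
    (fun _ _ _ _ => .of_subsingleton) (fun N _ _ ih _ => ?_) ‹_›
  exact (ih inferInstance).of_surjective_of_ker_le_center (QuotientGroup.mk'_surjective (center N))
    (QuotientGroup.ker_mk' _).le

end CentralExtension

end Polycyclic

section Finite

variable {E P : Type*} [Group E] [Group P]

theorem finite_of_finite_ker [Finite P] {f : E →* P} [Finite f.ker] : Finite E :=
  have : Finite (E ⧸ f.ker) := .of_injective _ (QuotientGroup.kerLift_injective f)
  .of_equiv _ (groupEquivQuotientProdSubgroup (s := f.ker)).symm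

theorem finite_of_finite_commutator [Finite (_root_.commutator E)] [Finite (Abelianization E)] :
    Finite E :=
  have : Finite (Abelianization.of (G := E)).ker := by rwa [Abelianization.ker_of]
  finite_of_finite_ker (f := Abelianization.of)

/-- By Schur's theorem the commutator subgroup of a central extension of a finite group is finite:
the commutator `⁅x, y⁆` depends only on the images of `x` and `y`. -/
theorem finite_commutator_of_ker_le_center [Finite P] {f : E →* P} (hker : f.ker ≤ center E) :
    Finite (_root_.commutator E) := by
  have hfactors : (fun p : E × E => ⁅p.1, p.2⁆).FactorsThrough (Prod.map f f) := by
    rintro ⟨x, y⟩ ⟨x', y'⟩ h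
    obtain ⟨hx, hy⟩ := Prod.mk.inj h
    have exists_center {a b : E} (hab : f a = f b) : ∃ z ∈ center E, a = b * z :=
      ⟨b⁻¹ * a, hker (by rw [MonoidHom.mem_ker, map_mul, map_inv, hab, inv_mul_cancel]), by group⟩
    obtain ⟨z, hz, rfl⟩ := exists_center hx
    obtain ⟨w, hw, rfl⟩ := exists_center hy
    have hz_comm (a : E) : ⁅z, a⁆ = 1 :=
      commutatorElement_eq_one_iff_mul_comm.mpr (mem_center_iff.mp hz a).symm
    have hw_comm (a : E) : ⁅a, w⁆ = 1 :=
      commutatorElement_eq_one_iff_mul_comm.mpr (mem_center_iff.mp hw a)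
    simp only [commutatorElement_mul_left_eq_conj_mul, commutatorElement_mul_right_eq_mul_conj,
      hz_comm, hw_comm, mul_one, mul_inv_cancel, one_mul, mul_inv_cancel_right]
  have hrange : commutatorSet E ⊆
      Set.range (Function.extend (Prod.map f f) (fun p : E × E => ⁅p.1, p.2⁆) 1) := by
    rintro _ ⟨x, y, rfl⟩
    exact ⟨(f x, f y), hfactors.extend_apply 1 (x, y)⟩
  have : Finite (commutatorSet E) := (Set.finite_range _).subset hrange
  infer_instance

theorem finite_of_ker_le_center [Finite P] [Finite (Abelianization E)] {f : E →* P}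
    (hker : f.ker ≤ center E) : Finite E :=
  have := finite_commutator_of_ker_le_center hker
  finite_of_finite_commutator

theorem abelianization_map_surjective {f : E →* P} (hf : Function.Surjective f) :
    Function.Surjective (Abelianization.map f) := fun a => by
  obtain ⟨b, rfl⟩ := QuotientGroup.mk'_surjective _ a
  obtain ⟨c, rfl⟩ := hf b
  exact ⟨Abelianization.of c, Abelianization.map_of f c⟩

theorem finite_of_isNilpotent [Group.IsNilpotent E] [Finite (Abelianization E)] : Finite E := by
  refine Group.nilpotent_center_quotient_ind
    (P := fun N _ _ => Finite (Abelianization N) → Finite N) E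
    (fun _ _ _ _ => inferInstance) (fun N _ _ ih _ => ?_) ‹_›
  have : Finite (Abelianization (N ⧸ center N)) :=
    .of_surjective _ (abelianization_map_surjective (QuotientGroup.mk'_surjective (center N)))
  have := ih this
  exact finite_of_ker_le_center (QuotientGroup.ker_mk' (center N)).le

theorem finite_of_forall_linearMap_int_eq_zero {A : Type*} [AddCommGroup A]
    [Module.Finite ℤ A] (h : ∀ f : A →ₗ[ℤ] ℤ, f = 0) : Finite A := by
  refine Module.finite_of_fg_torsion A fun {a} => ?_
  have ha : (Submodule.torsion ℤ A).mkQ a = 0 := by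
    rw [← Module.forall_dual_apply_eq_zero_iff ℤ]
    exact fun f => LinearMap.congr_fun (h (f.comp (Submodule.torsion ℤ A).mkQ)) a
  rwa [Submodule.mkQ_apply, Submodule.Quotient.mk_eq_zero] at ha

theorem finite_abelianization_of_forall_hom_eq_one [Group.FG E]
    (h : ∀ φ : E →* Multiplicative ℤ, φ = 1) : Finite (Abelianization E) := by
  have hfg : Group.FG (Abelianization E) :=
    Group.fg_of_surjective (f := Abelianization.of) (QuotientGroup.mk'_surjective _)
  have : Module.Finite ℤ (Additive (Abelianization E)) :=
    Module.Finite.iff_addGroup_fg.mpr inferInstance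
  refine finite_of_forall_linearMap_int_eq_zero (A := Additive (Abelianization E)) fun f => ?_
  have hf : AddMonoidHom.toMultiplicativeRight f.toAddMonoidHom = 1 :=
    Abelianization.hom_ext _ _ (h _)
  exact LinearMap.toAddMonoidHom_injective (AddMonoidHom.toMultiplicativeRight.injective hf)

end Finite

section LowerCentralSeries

variable (G : Type*) [Group G] (n : ℕ)

theorem isNilpotent_quotient_lowerCentralSeries :
    Group.IsNilpotent (G ⧸ (⊤ : Subgroup G).lowerCentralSeries n) := by
  let π := QuotientGroup.mk' ((⊤ : Subgroup G).lowerCentralSeries n)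
  refine Subgroup.nilpotent_iff_lowerCentralSeries.mpr ⟨n, ?_⟩
  rw [← map_top_of_surjective π (QuotientGroup.mk'_surjective _), ← map_lowerCentralSeries,
    QuotientGroup.map_mk'_self]

variable {G n}

theorem finite_of_finite_lowerCentralSeries [Finite (Abelianization G)]
    [Finite ((⊤ : Subgroup G).lowerCentralSeries n)] : Finite G := by
  let π := QuotientGroup.mk' ((⊤ : Subgroup G).lowerCentralSeries n)
  have := isNilpotent_quotient_lowerCentralSeries G n
  have : Finite (Abelianization (G ⧸ (⊤ : Subgroup G).lowerCentralSeries n)) :=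
    .of_surjective _ (abelianization_map_surjective (QuotientGroup.mk'_surjective _))
  have : Finite (G ⧸ (⊤ : Subgroup G).lowerCentralSeries n) := finite_of_isNilpotent
  have : Finite π.ker := by rwa [QuotientGroup.ker_mk']
  exact finite_of_finite_ker (f := π)

theorem IsPolycyclic.of_lowerCentralSeries [Group.FG G]
    (h : IsPolycyclic ((⊤ : Subgroup G).lowerCentralSeries n)) : IsPolycyclic G := by
  let π := QuotientGroup.mk' ((⊤ : Subgroup G).lowerCentralSeries n)
  have hker : IsPolycyclic π.ker := by rwa [QuotientGroup.ker_mk']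
  have := isNilpotent_quotient_lowerCentralSeries G n
  exact .of_ker hker .of_isNilpotent

end LowerCentralSeries

theorem prod_eq_pow_card_mul_of_cocycle {H M : Type*} [Group H] [Fintype H] [CommMonoid M]
    {f : H → M} (σ : H → M →* M) (hf : ∀ x y, f (x * y) = f y * σ y (f x)) (y : H) :
    ∏ x, f x = f y ^ Fintype.card H * σ y (∏ x, f x) := by
  calc ∏ x, f x = ∏ x, f (x * y) := (Equiv.prod_comp (Equiv.mulRight y) f).symm
    _ = f y ^ Fintype.card H * σ y (∏ x, f x) := by
      simp only [hf, Finset.prod_mul_distrib, Finset.prod_const, Finset.card_univ, map_prod]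

theorem map_conj_eq {E A : Type*} [Group E] [CommGroup A] (φ : E →* A) (x y : E) :
    φ (x⁻¹ * y * x) = φ y := by
  rw [map_mul, map_mul, map_inv, mul_comm, mul_inv_cancel_left]

theorem NonabTensor.closure_range_tmul {G : Type u} {H : Type v} [Group G] [Group H]
    (α : Hᵐᵒᵖ →* MulAut G) (β : Gᵐᵒᵖ →* MulAut H) :
    closure (Set.range fun p : G × H => NonabTensor.tmul α β p.1 p.2) = ⊤ :=
  PresentedGroup.closure_range_of _

namespace GroupOver

variable {G : Type u} [Group G] (T : GroupOver G)

/-- The generator `t ⊗ x` of `T ⊗ G`, with the two actions read off from `T`. -/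
def tmul (t : T.carrier) (x : G) : T.Tensor := NonabTensor.tmul T.act T.actOnBase t x

/-- The Peiffer identity, which makes the equivariant homomorphism `T.toBase` a crossed module. -/
def IsPeiffer : Prop := ∀ s t : T.carrier, T.act (op (T.toBase s)) t = s⁻¹ * t * s

theorem closure_range_tmul : closure (Set.range fun p : T.carrier × G => T.tmul p.1 p.2) = ⊤ :=
  NonabTensor.closure_range_tmul _ _

theorem diagAct_diagAct (g h : G) (y : T.Tensor) :
    T.diagAct (op h) (T.diagAct (op g) y) = T.diagAct (op (g * h)) y := by
  rw [op_mul, map_mul, MulAut.mul_apply]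

theorem diagAct_op_tmul (g : G) (t : T.carrier) (x : G) :
    T.diagAct (op g) (T.tmul t x) = T.tmul (T.act (op g) t) (g⁻¹ * x * g) :=
  T.diagAct_tmul g t x

theorem commHom_op_tmul (t : T.carrier) (x : G) :
    T.commHom (T.tmul t x) = (T.toBase t)⁻¹ * x⁻¹ * T.toBase t * x :=
  T.commHom_tmul t x

theorem tmul_mul_eq_tmul_mul_diagAct (t : T.carrier) (x y : G) :
    T.tmul t (x * y) = T.tmul t y * T.diagAct (op y) (T.tmul t x) := by
  rw [diagAct_op_tmul]
  exact NonabTensor.tmul_mul t x y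

theorem tmul_mul_eq_tmul_mul_tmul_act (t : T.carrier) (x y : G) :
    T.tmul t (x * y) = T.tmul t x * T.tmul (T.act (op x) t) y := by
  have hxy : x * y = x * y * x⁻¹ * x := by group
  rw [hxy, tmul_mul_eq_tmul_mul_diagAct, diagAct_op_tmul]
  congr 2
  group

theorem tmul_one (t : T.carrier) : T.tmul t 1 = 1 := by
  have h := T.tmul_mul_eq_tmul_mul_tmul_act t 1 1
  rw [one_mul, op_one, map_one, MulAut.one_apply] at h
  exact left_eq_mul.mp h

theorem tmul_inv (t : T.carrier) (x : G) :
    T.tmul t x⁻¹ = (T.tmul (T.act (op x⁻¹) t) x)⁻¹ := by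
  have h := T.tmul_mul_eq_tmul_mul_tmul_act (T.act (op x⁻¹) t) x x⁻¹
  rw [mul_inv_cancel, tmul_one, ← MulAut.mul_apply, ← map_mul, ← op_mul, inv_mul_cancel, op_one,
    map_one, MulAut.one_apply] at h
  exact (inv_eq_of_mul_eq_one_right h.symm).symm

variable {T}

theorem tmul_mem_of_mem_closure_right {M : Set T.carrier} (hM : ∀ g, ∀ m ∈ M, T.act (op g) m ∈ M)
    {S : Set G} {K : Subgroup T.Tensor} (hS : ∀ m ∈ M, ∀ s ∈ S, T.tmul m s ∈ K) {g : G}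
    (hg : g ∈ closure S) : ∀ m ∈ M, T.tmul m g ∈ K := by
  induction hg using closure_induction with
  | mem s hs => exact fun m hm => hS m hm s hs
  | one =>
    intro m _
    rw [tmul_one]
    exact one_mem K
  | mul x y _ _ hx hy =>
    intro m hm
    rw [tmul_mul_eq_tmul_mul_tmul_act]
    exact mul_mem (hx m hm) (hy _ (hM x m hm))
  | inv x _ hx =>
    intro m hm
    rw [tmul_inv]
    exact inv_mem (hx _ (hM x⁻¹ m hm))

namespace IsPeiffer

theorem mul_tmul_eq_diagAct_mul_tmul (hT : T.IsPeiffer) (t t₁ : T.carrier) (x : G) :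
    T.tmul (t * t₁) x = T.diagAct (op (T.toBase t₁)) (T.tmul t x) * T.tmul t₁ x := by
  rw [diagAct_op_tmul, hT, ← T.actOnBase_apply]
  exact NonabTensor.mul_tmul t t₁ x

theorem one_tmul (hT : T.IsPeiffer) (x : G) : T.tmul 1 x = 1 := by
  have h := hT.mul_tmul_eq_diagAct_mul_tmul 1 1 x
  rw [one_mul, map_one, op_one, map_one, MulAut.one_apply] at h
  exact left_eq_mul.mp h

/-- Both sides come from expanding `t t₁ ⊗ x x₁` in the two possible orders. -/
theorem diagAct_tmul_mul_tmul (hT : T.IsPeiffer) (t t₁ : T.carrier) (x x₁ : G) :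
    T.diagAct (op (x₁ * T.toBase t₁)) (T.tmul t x) * T.tmul t₁ x₁ =
      T.tmul t₁ x₁ * T.diagAct (op (T.toBase t₁ * x₁)) (T.tmul t x) := by
  have h_left := hT.mul_tmul_eq_diagAct_mul_tmul t t₁ (x * x₁)
  have h_right := T.tmul_mul_eq_tmul_mul_diagAct (t * t₁) x x₁
  rw [h_left, hT.mul_tmul_eq_diagAct_mul_tmul t t₁ x₁, hT.mul_tmul_eq_diagAct_mul_tmul t t₁ x,
    T.tmul_mul_eq_tmul_mul_diagAct t, T.tmul_mul_eq_tmul_mul_diagAct t₁] at h_right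
  simp only [map_mul, diagAct_diagAct, mul_assoc] at h_right
  have h_middle := mul_left_cancel h_right
  simp only [← mul_assoc] at h_middle
  exact mul_right_cancel h_middle

theorem diagAct_commHom_tmul (hT : T.IsPeiffer) (t : T.carrier) (x : G) (y : T.Tensor) :
    T.diagAct (op (T.commHom (T.tmul t x))) y = (T.tmul t x)⁻¹ * y * T.tmul t x := by
  have diagAct_eq_conj (z : T.Tensor) : T.diagAct (op (T.toBase t * x)) z =
      MulAut.conj (T.tmul t x)⁻¹ (T.diagAct (op (x * T.toBase t)) z) := by
    refine DFunLike.congr_fun (f := (T.diagAct (op (T.toBase t * x))).toMonoidHom)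
      (g := (MulAut.conj (T.tmul t x)⁻¹).toMonoidHom.comp
        (T.diagAct (op (x * T.toBase t))).toMonoidHom) (NonabTensor.hom_ext fun s z => ?_) z
    change T.diagAct (op (T.toBase t * x)) (T.tmul s z) =
      MulAut.conj (T.tmul t x)⁻¹ (T.diagAct (op (x * T.toBase t)) (T.tmul s z))
    rw [MulAut.conj_apply, inv_inv, mul_assoc, hT.diagAct_tmul_mul_tmul s t z x,
      inv_mul_cancel_left]
  have hcomm : T.commHom (T.tmul t x) = (x * T.toBase t)⁻¹ * (T.toBase t * x) := by
    rw [commHom_op_tmul]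
    group
  rw [hcomm, ← diagAct_diagAct, diagAct_eq_conj, diagAct_diagAct, inv_mul_cancel, op_one, map_one,
    MulAut.one_apply, MulAut.conj_apply, inv_inv]

theorem diagAct_commHom (hT : T.IsPeiffer) (x y : T.Tensor) :
    T.diagAct (op (T.commHom x)) y = x⁻¹ * y * x := by
  have hx : x ∈ closure (Set.range fun p : T.carrier × G => T.tmul p.1 p.2) :=
    T.closure_range_tmul ▸ mem_top x
  induction hx using closure_induction generalizing y with
  | mem x hx =>
    obtain ⟨p, rfl⟩ := hx
    exact hT.diagAct_commHom_tmul _ _ _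
  | one => simp
  | mul a b _ _ ha hb =>
    rw [map_mul, ← diagAct_diagAct, ha, hb]
    group
  | inv a _ ha =>
    have h := ha (T.diagAct (op (T.commHom a⁻¹)) y)
    rw [diagAct_diagAct, ← map_mul, inv_mul_cancel, map_one, op_one, map_one,
      MulAut.one_apply] at h
    nth_rw 2 [h]
    group

theorem tensor (hT : T.IsPeiffer) : T.tensor.IsPeiffer := hT.diagAct_commHom

theorem ker_commHom_le_center (hT : T.IsPeiffer) : T.commHom.ker ≤ center T.Tensor := by
  intro y hy
  refine mem_center_iff.mpr fun x => ?_
  have h := hT.diagAct_commHom y x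
  rw [MonoidHom.mem_ker.mp hy, op_one, map_one, MulAut.one_apply, mul_assoc] at h
  exact (eq_inv_mul_iff_mul_eq.mp h).symm

theorem diagAct_tmul_eq (hT : T.IsPeiffer) (t : T.carrier) (g h : G) :
    T.diagAct (op h) (T.tmul t g) = T.tmul t g * T.tmul (t⁻¹ * T.act (op g) t) h := by
  have hcomm : T.toBase (t⁻¹ * T.act (op g) t) = T.commHom (T.tmul t g) := by
    rw [commHom_op_tmul, map_mul, map_inv, T.equivariant]
    group
  have h_act : T.tmul (T.act (op g) t) h =
      (T.tmul t g)⁻¹ * T.tmul t h * T.tmul t g * T.tmul (t⁻¹ * T.act (op g) t) h := by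
    rw [← hT.diagAct_commHom, ← hcomm, ← hT.mul_tmul_eq_diagAct_mul_tmul, mul_inv_cancel_left]
  have h_mul : T.tmul t h * T.diagAct (op h) (T.tmul t g) =
      T.tmul t g * T.tmul (T.act (op g) t) h := by
    rw [← tmul_mul_eq_tmul_mul_diagAct, tmul_mul_eq_tmul_mul_tmul_act]
  rw [← mul_right_inj (T.tmul t h), h_mul, h_act]
  group

theorem mul_tmul (hT : T.IsPeiffer) (t t₁ : T.carrier) (g : G) :
    T.tmul (t * t₁) g =
      T.tmul t g * T.tmul (t⁻¹ * T.act (op g) t) (T.toBase t₁) * T.tmul t₁ g := by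
  rw [hT.mul_tmul_eq_diagAct_mul_tmul, hT.diagAct_tmul_eq]

theorem tmul_mem_of_mem_closure_left (hT : T.IsPeiffer) {A : Set T.carrier} {g : G}
    {K : Subgroup T.Tensor} (hA : ∀ a ∈ A, T.tmul a g ∈ K)
    (hcomm : ∀ m ∈ closure A, ∀ m₁ ∈ closure A,
      T.tmul (m⁻¹ * T.act (op g) m) (T.toBase m₁) ∈ K)
    {m : T.carrier} (hm : m ∈ closure A) : T.tmul m g ∈ K := by
  induction hm using closure_induction with
  | mem a ha => exact hA a ha
  | one =>
    rw [hT.one_tmul]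
    exact one_mem K
  | mul x y hx hy hxK hyK =>
    rw [hT.mul_tmul]
    exact mul_mem (mul_mem hxK (hcomm x hx y hy)) hyK
  | inv x hx hxK =>
    have h := hT.mul_tmul x x⁻¹ g
    rw [mul_inv_cancel, hT.one_tmul] at h
    rw [← inv_eq_of_mul_eq_one_right h.symm]
    exact inv_mem (mul_mem hxK (hcomm x hx x⁻¹ (inv_mem hx)))

end IsPeiffer

theorem isPeiffer_self (G : Type u) [Group G] : (self G).IsPeiffer :=
  fun s t => rightConj_apply s t

theorem isPeiffer_tensorPow (G : Type u) [Group G] : ∀ n, (tensorPow G n).IsPeiffer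
  | 0 => isPeiffer_self G
  | 1 => isPeiffer_self G
  | n + 2 => (isPeiffer_tensorPow G (n + 1)).tensor

variable (G) in
theorem lowerCentralSeries_le_range_toBase (n : ℕ) :
    (⊤ : Subgroup G).lowerCentralSeries n ≤ (tensorPow G (n + 1)).toBase.range := by
  induction n with
  | zero => exact fun g _ => ⟨g, rfl⟩
  | succ n ih =>
    rw [Subgroup.lowerCentralSeries_succ, commutator_le]
    intro p hp q _
    obtain ⟨t, rfl⟩ := ih hp
    refine ⟨(tensorPow G (n + 1)).tmul t⁻¹ q⁻¹, (commHom_op_tmul _ _ _).trans ?_⟩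
    rw [map_inv, inv_inv, inv_inv, commutatorElement_def]

section Polycyclic

/-- The subgroup of `T ⊗ G` generated by the symbols `n ⊗ g` with `n ∈ N`, through which
generation of `T ⊗ G` is reduced to the layers of the derived series of `T`. -/
def tmulSubgroup (T : GroupOver G) (N : Subgroup T.carrier) : Subgroup T.Tensor :=
  closure (Set.image2 T.tmul N Set.univ)

theorem tmulSubgroup_le_iff {N : Subgroup T.carrier} {K : Subgroup T.Tensor} :
    T.tmulSubgroup N ≤ K ↔ ∀ n ∈ N, ∀ g, T.tmul n g ∈ K := by
  simp only [tmulSubgroup, closure_le, Set.image2_subset_iff, Set.mem_univ, forall_true_left,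
    SetLike.mem_coe]

theorem tmul_mem_tmulSubgroup {N : Subgroup T.carrier} {n : T.carrier} (hn : n ∈ N) (g : G) :
    T.tmul n g ∈ T.tmulSubgroup N :=
  tmulSubgroup_le_iff.mp le_rfl n hn g

theorem tmulSubgroup_mono {N M : Subgroup T.carrier} (hNM : N ≤ M) :
    T.tmulSubgroup N ≤ T.tmulSubgroup M :=
  tmulSubgroup_le_iff.mpr fun _ hn g => tmul_mem_tmulSubgroup (hNM hn) g

theorem tmulSubgroup_top : T.tmulSubgroup ⊤ = ⊤ := by
  rw [eq_top_iff, ← T.closure_range_tmul, closure_le]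
  rintro _ ⟨p, rfl⟩
  exact tmul_mem_tmulSubgroup (mem_top _) _

namespace IsPeiffer

theorem tmulSubgroup_bot (hT : T.IsPeiffer) : T.tmulSubgroup ⊥ = ⊥ :=
  eq_bot_iff.mpr <| tmulSubgroup_le_iff.mpr fun n hn g => by
    rw [mem_bot.mp hn, hT.one_tmul]
    exact one_mem _

theorem tmulSubgroup_closure_le (hT : T.IsPeiffer) {A : Set T.carrier} {N : Subgroup T.carrier}
    {S : Set G} {K : Subgroup T.Tensor} (hA : ∀ g, ∀ m ∈ closure A, T.act (op g) m ∈ closure A)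
    (hS : closure S = ⊤) (hAN : ⁅closure A, closure A⁆ ≤ N) (hN : T.tmulSubgroup N ≤ K)
    (hAA : ∀ a ∈ A, ∀ b ∈ A, T.tmul a (T.toBase b) ∈ K) (hAS : ∀ a ∈ A, ∀ s ∈ S, T.tmul a s ∈ K) :
    T.tmulSubgroup (closure A) ≤ K := by
  have comm_act_toBase_mem (m : T.carrier) (hm : m ∈ closure A) (b : T.carrier)
      (hb : b ∈ closure A) : m⁻¹ * T.act (op (T.toBase b)) m ∈ N := by
    have h := hAN (commutator_mem_commutator (inv_mem hm) (inv_mem hb))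
    rwa [commutatorElement_def, inv_inv, inv_inv, mul_assoc, mul_assoc, ← mul_assoc b⁻¹,
      ← hT] at h
  have tmul_toBase_generator (m : T.carrier) (hm : m ∈ closure A) (x : G)
      (hx : x ∈ T.toBase '' A) : T.tmul m x ∈ K := by
    obtain ⟨b, hb, rfl⟩ := hx
    exact hT.tmul_mem_of_mem_closure_left (fun a ha => hAA a ha b hb) (fun m hm _ _ =>
      hN (tmul_mem_tmulSubgroup (comm_act_toBase_mem m hm b (mem_closure_of_mem hb)) _)) hm
  have tmul_toBase (m : T.carrier) (hm : m ∈ closure A) (m₁ : T.carrier) (hm₁ : m₁ ∈ closure A) :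
      T.tmul m (T.toBase m₁) ∈ K :=
    tmul_mem_of_mem_closure_right hA tmul_toBase_generator
      (T.toBase.map_closure A ▸ mem_map_of_mem T.toBase hm₁) m hm
  have tmul_generator (m : T.carrier) (hm : m ∈ closure A) (s : G) (hs : s ∈ S) : T.tmul m s ∈ K :=
    hT.tmul_mem_of_mem_closure_left (fun a ha => hAS a ha s hs)
      (fun m hm m₁ hm₁ => tmul_toBase _ (mul_mem (inv_mem hm) (hA s m hm)) m₁ hm₁) hm
  exact tmulSubgroup_le_iff.mpr fun m hm g =>
    tmul_mem_of_mem_closure_right hA tmul_generator (hS ▸ mem_top g) m hm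

theorem tmulSubgroup_fg [Group.FG G] (hT : T.IsPeiffer) {M N : Subgroup T.carrier} (hM : M.FG)
    (hM_act : ∀ g, ∀ m ∈ M, T.act (op g) m ∈ M) (hNM : N ≤ M) (hMN : ⁅M, M⁆ ≤ N)
    (hN : (T.tmulSubgroup N).FG) : (T.tmulSubgroup M).FG := by
  obtain ⟨A, rfl, hA⟩ := (fg_iff _).mp hM
  obtain ⟨S, hS, hSfin⟩ := Group.fg_iff.mp ‹Group.FG G›
  set F := Set.image2 T.tmul A (T.toBase '' A ∪ S)
  have tmul_mem {a : T.carrier} (ha : a ∈ A) {x : G} (hx : x ∈ T.toBase '' A ∪ S) :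
      T.tmul a x ∈ T.tmulSubgroup N ⊔ closure F :=
    mem_sup_right (mem_closure_of_mem (Set.mem_image2_of_mem ha hx))
  have hsup : T.tmulSubgroup (closure A) = T.tmulSubgroup N ⊔ closure F := by
    refine le_antisymm (hT.tmulSubgroup_closure_le hM_act hS hMN le_sup_left
      (fun a ha b hb => tmul_mem ha (.inl ⟨b, hb, rfl⟩)) (fun a ha s hs => tmul_mem ha (.inr hs)))
      (sup_le (tmulSubgroup_mono hNM) ((closure_le _).mpr ?_))
    exact Set.image2_subset_iff.mpr fun a ha x _ => tmul_mem_tmulSubgroup (mem_closure_of_mem ha) x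
  rw [hsup]
  exact hN.sup ((fg_iff _).mpr ⟨F, rfl, hA.image2 _ ((hA.image _).union hSfin)⟩)

theorem fg_tensor [Group.FG G] [Group.IsSolvable T.carrier] (hT : T.IsPeiffer)
    (hfg : ∀ i, (derivedSeries T.carrier i).FG) : Group.FG T.Tensor := by
  have act_mem (i : ℕ) (g : G) (t : T.carrier) (ht : t ∈ derivedSeries T.carrier i) :
      T.act (op g) t ∈ derivedSeries T.carrier i :=
    characteristic_iff_map_le.mp (derivedSeries_characteristic T.carrier i) (T.act (op g))
      (mem_map_of_mem _ ht)
  obtain ⟨k, hk⟩ := (Group.isSolvable_def T.carrier).mp ‹_›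
  have tmulSubgroup_derivedSeries_fg : (T.tmulSubgroup (derivedSeries T.carrier 0)).FG := by
    refine Nat.decreasingInduction'
      (P := fun i => (T.tmulSubgroup (derivedSeries T.carrier i)).FG)
      (fun i _ _ ih => ?_) k.zero_le ?_
    · exact hT.tmulSubgroup_fg (hfg i) (act_mem i) (derivedSeries_antitone T.carrier i.le_succ)
        le_rfl ih
    · rw [hk, hT.tmulSubgroup_bot]
      exact FG.bot
  rw [derivedSeries_zero, tmulSubgroup_top] at tmulSubgroup_derivedSeries_fg
  exact Group.fg_def.mpr tmulSubgroup_derivedSeries_fg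

theorem isPolycyclic_tensor (hT : T.IsPeiffer) (hG : IsPolycyclic G)
    (hTc : IsPolycyclic T.carrier) : IsPolycyclic T.Tensor := by
  have := hG.fg
  have := hTc.isSolvable
  have : Group.FG T.Tensor := hT.fg_tensor fun i => hTc.fg_subgroup _
  refine (hG.of_injective T.commHom.range.subtype_injective).of_surjective_of_ker_le_center
    T.commHom.rangeRestrict_surjective ?_
  rw [MonoidHom.ker_rangeRestrict]
  exact hT.ker_commHom_le_center

end IsPeiffer

theorem isPolycyclic_tensorPow (hG : IsPolycyclic G) : ∀ n, IsPolycyclic (tensorPow G n).carrier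
  | 0 | 1 => hG
  | n + 2 =>
    (isPeiffer_tensorPow G (n + 1)).isPolycyclic_tensor hG (isPolycyclic_tensorPow hG (n + 1))

end Polycyclic

section Finite

/-- The action of `G` on the abelianization of `T ⊗ G` induced by the diagonal action. -/
def abAct (T : GroupOver G) (g : G) : Abelianization T.Tensor →* Abelianization T.Tensor :=
  Abelianization.map (T.diagAct (op g)).toMonoidHom

theorem abAct_of (g : G) (y : T.Tensor) :
    T.abAct g (Abelianization.of y) = Abelianization.of (T.diagAct (op g) y) :=
  Abelianization.map_of _ _

section

variable [Fintype G]

/-- The product of the symbols `t ⊗ g` over all `g : G`, taken in the abelianization of `T ⊗ G`;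
it averages the cocycle `g ↦ t ⊗ g`. -/
noncomputable def tmulProd (T : GroupOver G) (t : T.carrier) : Abelianization T.Tensor :=
  ∏ g : G, Abelianization.of (T.tmul t g)

theorem tmulProd_eq_pow_card_mul (t : T.carrier) (x : G) :
    T.tmulProd t = Abelianization.of (T.tmul t x) ^ Fintype.card G * T.abAct x (T.tmulProd t) :=
  prod_eq_pow_card_mul_of_cocycle (f := fun g => Abelianization.of (T.tmul t g)) T.abAct
    (fun x y => by rw [tmul_mul_eq_tmul_mul_diagAct, map_mul, abAct_of]) x

theorem abAct_tmulProd (h : G) (t : T.carrier) :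
    T.abAct h (T.tmulProd t) = T.tmulProd (T.act (op h) t) := by
  simp only [tmulProd, map_prod, abAct_of, diagAct_op_tmul]
  refine Fintype.prod_equiv (MulAut.conj h⁻¹).toEquiv _ _ fun g => ?_
  simp

namespace IsPeiffer

theorem tmulProd_mul (hT : T.IsPeiffer) (t t₁ : T.carrier) :
    T.tmulProd (t * t₁) = T.tmulProd t₁ * T.abAct (T.toBase t₁) (T.tmulProd t) := by
  simp only [tmulProd, hT.mul_tmul_eq_diagAct_mul_tmul, map_mul, ← abAct_of,
    Finset.prod_mul_distrib, map_prod, mul_comm]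

variable [Fintype T.carrier]

theorem tmulProd_pow_card (hT : T.IsPeiffer) (t : T.carrier) :
    T.tmulProd t ^ Fintype.card T.carrier = 1 := by
  have abAct_prod (h : G) : T.abAct h (∏ t, T.tmulProd t) = ∏ t, T.tmulProd t := by
    simp only [map_prod, abAct_tmulProd]
    exact Equiv.prod_comp (T.act (op h)).toEquiv T.tmulProd
  have h := prod_eq_pow_card_mul_of_cocycle (fun s => T.abAct (T.toBase s)) hT.tmulProd_mul t
  rw [abAct_prod] at h
  exact right_eq_mul.mp h

theorem of_tmul_pow_card_mul_card (hT : T.IsPeiffer) (t : T.carrier) (x : G) :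
    Abelianization.of (T.tmul t x) ^ (Fintype.card G * Fintype.card T.carrier) = 1 := by
  have h := congrArg (· ^ Fintype.card T.carrier) (tmulProd_eq_pow_card_mul t x)
  simp only [mul_pow, ← map_pow, hT.tmulProd_pow_card, map_one, mul_one] at h
  rw [pow_mul, ← map_pow, ← map_pow]
  exact h.symm

end IsPeiffer

end

theorem fg_tensor_of_finite (T : GroupOver G) [Finite G] [Finite T.carrier] : Group.FG T.Tensor :=
  Group.fg_iff.mpr ⟨_, T.closure_range_tmul, Set.finite_range _⟩

namespace IsPeiffer

theorem finite_abelianization_tensor [Finite G] [Finite T.carrier] (hT : T.IsPeiffer) :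
    Finite (Abelianization T.Tensor) := by
  have := Fintype.ofFinite G
  have := Fintype.ofFinite T.carrier
  have := T.fg_tensor_of_finite
  have : Group.FG (Abelianization T.Tensor) :=
    Group.fg_of_surjective (f := Abelianization.of) (QuotientGroup.mk'_surjective _)
  have hpow : (powMonoidHom (Fintype.card G * Fintype.card T.carrier)).comp
      (Abelianization.of (G := T.Tensor)) = 1 :=
    NonabTensor.hom_ext fun t x => hT.of_tmul_pow_card_mul_card t x
  have : IsMulTorsion (Abelianization T.Tensor) := fun a => by
    obtain ⟨y, rfl⟩ := QuotientGroup.mk'_surjective _ a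
    exact isOfFinOrder_iff_pow_eq_one.mpr
      ⟨_, Nat.mul_pos Fintype.card_pos Fintype.card_pos, DFunLike.congr_fun hpow y⟩
  exact CommGroup.finite_of_fg_isMulTorsion _ this

theorem finite_tensor [Finite G] [Finite T.carrier] (hT : T.IsPeiffer) : Finite T.Tensor :=
  have := hT.finite_abelianization_tensor
  finite_of_ker_le_center hT.ker_commHom_le_center

end IsPeiffer

variable (G) in
theorem finite_tensorPow [Finite G] : ∀ n, Finite (tensorPow G n).carrier
  | 0 | 1 => ‹Finite G›
  | n + 2 =>
    have := finite_tensorPow (n + 1)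
    (isPeiffer_tensorPow G (n + 1)).finite_tensor

end Finite

section Pairing

variable {R : Type*} [NonUnitalNonAssocRing R]

/-- The homomorphism `t ⊗ x ↦ ψ t * φ x` to the additive group of `R`, for `G`-invariant `ψ`. -/
def pairingHom (ψ : T.carrier →* Multiplicative R) (hψ : ∀ g t, ψ (T.act (op g) t) = ψ t)
    (φ : G →* Multiplicative R) : T.Tensor →* Multiplicative R :=
  NonabTensor.lift (fun t x => .ofAdd ((ψ t).toAdd * (φ x).toAdd))
    (fun t t₁ x => by
      simp only [actOnBase_apply, map_conj_eq]
      rw [map_mul ψ, toAdd_mul, add_mul, ofAdd_add])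
    (fun t x x₁ => by
      simp only [hψ, map_conj_eq]
      rw [map_mul φ, toAdd_mul, mul_add, add_comm, ofAdd_add])

variable {ψ : T.carrier →* Multiplicative R} {hψ : ∀ g t, ψ (T.act (op g) t) = ψ t}
  {φ : G →* Multiplicative R}

theorem pairingHom_tmul (t : T.carrier) (x : G) :
    pairingHom ψ hψ φ (T.tmul t x) = .ofAdd ((ψ t).toAdd * (φ x).toAdd) :=
  NonabTensor.lift_tmul _ _ _ _ _

theorem pairingHom_diagAct (g : G) (y : T.Tensor) :
    pairingHom ψ hψ φ (T.diagAct (op g) y) = pairingHom ψ hψ φ y := by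
  refine DFunLike.congr_fun (f := (pairingHom ψ hψ φ).comp (T.diagAct (op g)).toMonoidHom)
    (NonabTensor.hom_ext fun t x => ?_) y
  change pairingHom ψ hψ φ (T.diagAct (op g) (T.tmul t x)) = pairingHom ψ hψ φ (T.tmul t x)
  rw [diagAct_op_tmul, pairingHom_tmul, pairingHom_tmul, hψ, map_conj_eq]

theorem pairingHom_ne_one [NoZeroDivisors R] (hψ_ne : ψ ≠ 1) (hφ_ne : φ ≠ 1) :
    pairingHom ψ hψ φ ≠ 1 := by
  obtain ⟨t, ht⟩ := DFunLike.exists_ne hψ_ne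
  obtain ⟨x, hx⟩ := DFunLike.exists_ne hφ_ne
  intro h
  have htx := DFunLike.congr_fun h (T.tmul t x)
  rw [pairingHom_tmul] at htx
  exact (mul_eq_zero.mp (ofAdd_eq_one.mp htx)).elim (ht ∘ toAdd_eq_zero.mp) (hx ∘ toAdd_eq_zero.mp)

theorem exists_invariant_hom_tensorPow_ne_one [NoZeroDivisors R] (hφ : φ ≠ 1) :
    ∀ n, ∃ ψ : (tensorPow G n).carrier →* Multiplicative R,
      ψ ≠ 1 ∧ ∀ g t, ψ ((tensorPow G n).act (op g) t) = ψ t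
  | 0 | 1 => ⟨φ, hφ, fun g t => (congrArg φ (rightConj_apply g t)).trans (map_conj_eq φ g t)⟩
  | n + 2 => by
    obtain ⟨ψ, hψ_ne, hψ⟩ := exists_invariant_hom_tensorPow_ne_one hφ (n + 1)
    exact ⟨pairingHom ψ hψ φ, pairingHom_ne_one hψ_ne hφ, pairingHom_diagAct⟩

theorem hom_eq_one_of_finite_tensorPow (n : ℕ) [Finite (tensorPow G n).carrier]
    (φ : G →* Multiplicative ℤ) : φ = 1 := by
  by_contra hφ
  obtain ⟨ψ, hψ, -⟩ := exists_invariant_hom_tensorPow_ne_one hφ n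
  refine hψ (MonoidHom.ext fun t => ?_)
  have h : ψ t ^ Nat.card (tensorPow G n).carrier = 1 := by
    rw [← map_pow, pow_card_eq_one', map_one]
  exact (pow_eq_one_iff_left Nat.card_pos.ne').mp h

end Pairing

variable (G) in
theorem finite_of_finite_tensorPow [Group.FG G] (n : ℕ) [Finite (tensorPow G (n + 1)).carrier] :
    Finite G :=
  have : Finite (Abelianization G) :=
    finite_abelianization_of_forall_hom_eq_one (hom_eq_one_of_finite_tensorPow (n + 1))
  have : Finite ((⊤ : Subgroup G).lowerCentralSeries n) :=
    (Set.finite_range (tensorPow G (n + 1)).toBase).subset (lowerCentralSeries_le_range_toBase G n)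
  finite_of_finite_lowerCentralSeries (n := n)

theorem isPolycyclic_of_isPolycyclic_tensorPow [Group.FG G] {n : ℕ}
    (h : IsPolycyclic (tensorPow G (n + 1)).carrier) : IsPolycyclic G :=
  .of_lowerCentralSeries <|
    (h.of_surjective (tensorPow G (n + 1)).toBase.rangeRestrict_surjective).of_injective
      (inclusion_injective (lowerCentralSeries_le_range_toBase G n))

end GroupOver

theorem mainTheorem2 {G : Type*} [Group G] [Group.FG G] (n : ℕ) (hn : 1 ≤ n) :
    (Finite (NFoldTensor G n) ↔ Finite G) ∧
      (IsPolycyclic (NFoldTensor G n) ↔ IsPolycyclic G) := by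
  obtain ⟨n, rfl⟩ := Nat.exists_eq_add_of_le' hn
  exact ⟨⟨fun _ => GroupOver.finite_of_finite_tensorPow G n,
      fun _ => GroupOver.finite_tensorPow G (n + 1)⟩,
    GroupOver.isPolycyclic_of_isPolycyclic_tensorPow,
    fun h => GroupOver.isPolycyclic_tensorPow h (n + 1)⟩
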